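/- Let $A_0,A_1$ be real $2\times2$ matrices with $\det A_0=\det A_1=1$ (for instance, two hyperbolic toral automorphisms of determinant $1$), and let $p\in[0,1]$. Let $\mathbb P$ be the product probability measure on $\Omega=\{0,1\}^{\mathbb N}$ under which the symbols $\omega(n)$ are independent, equal to $0$ with probability $p$ and to $1$ with probability $1-p$, and let $\tau$ be the left shift on $\Omega$. For a matrix $M$ write $\widetilde M=(M^T)^{-1}$, let $J=\bigl(\begin{smallmatrix}0&1\\-1&0\end{smallmatrix}\bigr)$, and put $$A_\omega^n=A_{\omega(n-1)}\cdots A_{\omega(0)},\qquad \widetilde A_\omega^n=\widetilde A_{\omega(n-1)}\cdots\widetilde A_{\omega(0)},\qquad A_\omega^0=\widetilde A_\omega^0=I .$$ Write $\Lambda_\omega=\lim_{n\to\infty}\bigl((A_\omega^n)^TA_\omega^n\bigr)^{1/2n}$ and $\widetilde\Lambda_\omega=\lim_{n\to\infty}\bigl((\widetilde A_\omega^n)^T\widetilde A_\omega^n\bigr)^{1/2n}$ when these limits exist. The Lyapunov exponents of $(A^n_\omega)_n$, respectively $(\widetilde A^n_\omega)_n$, at $\omega$ are the numbers $\chi$ such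 that $e^{\chi}$ is an eigenvalue of $\Lambda_\omega$, respectively $\widetilde\Lambda_\omega$. Then: 1. There is a measurable set $\Gamma\subset\Omega$ with $\tau\Gamma\subset\Gamma$ and $\mathbb P(\Gamma)=1$ such that the limit $\Lambda_\omega$ exists for every $\omega\in\Gamma$. 2. For all $\omega\in\Omega$ and $n\ge 0$, $\widetilde A_\omega^n=((A_\omega^n)^T)^{-1}$. 3. For every $\omega\in\Omega$ for which $\Lambda_\omega$ exists (in particular for every $\omega\in\Gamma$), $\det\Lambda_\omega=1$, the limit $\widetilde\Lambda_\omega$ exists, and $$\widetilde\Lambda_\omega=\lim_{n\to\infty}\bigl((\widetilde A_\omega^n)^T\widetilde A_\omega^n\bigr)^{1/2n}=J\Lambda_\omega J^{-1}=(\Lambda_\omega)^{-1}.$$ 4. For every $\omega\in\Omega$, the sets of Lyapunov exponents of $(\widetilde A_\omega^n)_n$ and of $(A_\omega^n)_n$ at $\omega$ coincide (a set of exponents being empty if the limit in question does not exist), and so do the sets of exponential growth rates, that is, the sets of real numbers of the form $\lim_{n\to\infty}\frac1n\ln|\widetilde A_\omega^nx|$, respectively $\lim_{n\to\infty}\frac1n\ln|A_\omega^nx|$,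 with $x\in\mathbb R^2\setminus\{0\}$ for which this limit exists in $\mathbb R$. -/

import Mathlib

open Filter Topology MeasureTheory

noncomputable section

/-- The symplectic matrix `J` with rows `(0, 1)` and `(-1, 0)`. -/
def symplJ : Matrix (Fin 2) (Fin 2) ℝ := !![0, 1; -1, 0]

/-- The inverse transpose `(Mᵀ)⁻¹` of a matrix `M`. -/
def tilde (M : Matrix (Fin 2) (Fin 2) ℝ) : Matrix (Fin 2) (Fin 2) ℝ := (M.transpose)⁻¹

/-- The left shift `τ (ω 0, ω 1, …) = (ω 1, ω 2, …)` on the space of sequences in two symbols. -/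
def shift (ω : ℕ → Fin 2) : ℕ → Fin 2 := fun n => ω (n + 1)

/-- The distribution of one symbol: `0` with probability `p` and `1` with probability `1 - p`. -/
def symbolMeasure (p : unitInterval) : Measure (Fin 2) :=
  ENNReal.ofReal (p : ℝ) • Measure.dirac 0 + ENNReal.ofReal (1 - (p : ℝ)) • Measure.dirac 1

instance (p : unitInterval) : IsProbabilityMeasure (symbolMeasure p) := by
  constructor
  simp only [symbolMeasure, Measure.add_apply, Measure.smul_apply, measure_univ, smul_eq_mul,
    mul_one]
  rw [← ENNReal.ofReal_add p.2.1 (sub_nonneg.mpr p.2.2)]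
  simp

/-- The product (Bernoulli) measure on sequences: the symbols `ω 0, ω 1, …` are independent, each
with the distribution `symbolMeasure p`. -/
def bernoulliSeq (p : unitInterval) : Measure (ℕ → Fin 2) :=
  Measure.infinitePi fun _ => symbolMeasure p

/-- The cocycle `A_ω^n = A_{ω(n-1)} ⋯ A_{ω(0)}`, with `A_ω^0 = 1`. -/
def cocycle (A : Fin 2 → Matrix (Fin 2) (Fin 2) ℝ) (ω : ℕ → Fin 2) :
    ℕ → Matrix (Fin 2) (Fin 2) ℝ
  | 0 => 1
  | n + 1 => A (ω n) * cocycle A ω n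

/-- The symmetric matrix `(Mᵀ M)^t`: the eigenvalues of the positive semidefinite matrix `Mᵀ M` are
raised to the real power `t` (functional calculus of a symmetric matrix). -/
def gramPow (M : Matrix (Fin 2) (Fin 2) ℝ) (t : ℝ) : Matrix (Fin 2) (Fin 2) ℝ :=
  cfc (fun x : ℝ => x ^ t) (M.transpose * M)

/-- `Λ = lim_{n → ∞} (M_nᵀ M_n)^{1/(2n)}`. -/
def IsOseledetsLimit (M : ℕ → Matrix (Fin 2) (Fin 2) ℝ) (Λ : Matrix (Fin 2) (Fin 2) ℝ) : Prop :=
  Tendsto (fun n : ℕ => gramPow (M n) (1 / (2 * (n : ℝ)))) atTop (𝓝 Λ)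

/-- The Lyapunov exponents of a sequence `M_n`: the numbers `χ` such that `exp χ` is an eigenvalue
of `lim_{n → ∞} (M_nᵀ M_n)^{1/(2n)}`. -/
def lyapunovExponents (M : ℕ → Matrix (Fin 2) (Fin 2) ℝ) : Set ℝ :=
  {χ | ∃ Λ, IsOseledetsLimit M Λ ∧ Module.End.HasEigenvalue (Matrix.toLin' Λ) (Real.exp χ)}

/-- The exponential growth rates `lim_{n → ∞} (1/n) ln |M_n x|` that are attained at vectors
`x ≠ 0`, where `|·|` is the Euclidean norm. -/
def growthRates (M : ℕ → Matrix (Fin 2) (Fin 2) ℝ) : Set ℝ :=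
  {χ | ∃ x : EuclideanSpace ℝ (Fin 2), x ≠ 0 ∧
    Tendsto (fun n : ℕ => 1 / (n : ℝ) * Real.log ‖Matrix.toEuclideanLin (M n) x‖) atTop (𝓝 χ)}

end

/-! For determinant `1` in dimension two the inverse is the adjugate, so `tilde M = J M J⁻¹` with
`J` orthogonal. Hence Gram matrices, their real powers and any limit `Λ` are conjugated by `J`.
Since `Λ` is symmetric of determinant `1`, the conjugate is also `Λ⁻¹`. Similar matrices share
eigenvalues and `|tilde M (J x)| = |M x|`, which settles the exponents and growth rates.

The substance is almost sure existence of `Λ`. A Gram matrix `G` of determinant `1` and trace `T`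
has eigenvalues `m, m⁻¹` with `m + m⁻¹ = T`, so `G ^ t` is affine in `G` (`gramPow_eq_affine`). Two
facts then suffice. First, `log T_n / n` converges to a constant `L`
(`ae_tendsto_log_frobSq_cocycle`): the upper bound is the strong law on independent blocks, the
lower bound a Katznelson–Weiss covering argument. Secondly, if `L > 0` then `G_n / T_n` converges,
because consecutive terms are exponentially close (`gram_diff_sq_le`). If `L = 0`, the powers have
determinant `1` and trace tending to `2`, which forces the identity. -/

/-! ### Real powers of Gram matrices of determinant one -/

/-- The squared Frobenius norm of a matrix. -/
def frobSq (M : Matrix (Fin 2) (Fin 2) ℝ) : ℝ := (M.transpose * M).trace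

theorem frobSq_eq (M : Matrix (Fin 2) (Fin 2) ℝ) :
    frobSq M = M 0 0 ^ 2 + M 0 1 ^ 2 + M 1 0 ^ 2 + M 1 1 ^ 2 := by
  simp [frobSq, Matrix.trace, Matrix.mul_apply, Fin.sum_univ_two]
  ring

/-- Cauchy–Schwarz for each entry of the product; the squares given to `nlinarith` are the defects
in Lagrange's identity. -/
theorem frobSq_mul_le (M N : Matrix (Fin 2) (Fin 2) ℝ) :
    frobSq (M * N) ≤ frobSq M * frobSq N := by
  simp only [frobSq_eq, Matrix.mul_apply, Fin.sum_univ_two]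
  nlinarith [sq_nonneg (M 0 0 * N 1 0 - M 0 1 * N 0 0), sq_nonneg (M 0 0 * N 1 1 - M 0 1 * N 0 1),
    sq_nonneg (M 1 0 * N 1 0 - M 1 1 * N 0 0), sq_nonneg (M 1 0 * N 1 1 - M 1 1 * N 0 1)]

/-- `frobSq M - 2 * M.det` is a sum of two squares. -/
theorem two_le_frobSq {M : Matrix (Fin 2) (Fin 2) ℝ} (hM : M.det = 1) : 2 ≤ frobSq M := by
  rw [Matrix.det_fin_two] at hM
  rw [frobSq_eq]
  nlinarith [sq_nonneg (M 0 0 - M 1 1), sq_nonneg (M 0 1 + M 1 0)]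

/-- The larger root of `x ^ 2 - T * x + 1`. -/
noncomputable def topEigenvalue (T : ℝ) : ℝ := (T + √(T ^ 2 - 4)) / 2

theorem one_le_topEigenvalue {T : ℝ} (hT : 2 ≤ T) : 1 ≤ topEigenvalue T := by
  have := Real.sqrt_nonneg (T ^ 2 - 4)
  rw [topEigenvalue]; linarith

theorem topEigenvalue_add_inv {T : ℝ} (hT : 2 ≤ T) :
    topEigenvalue T + (topEigenvalue T)⁻¹ = T := by
  have h1 : (topEigenvalue T) ≠ 0 := by linarith [one_le_topEigenvalue hT]
  have h2 : √(T ^ 2 - 4) ^ 2 = T ^ 2 - 4 := Real.sq_sqrt (by nlinarith)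
  field_simp
  rw [topEigenvalue]
  nlinarith

theorem half_le_topEigenvalue (T : ℝ) : T / 2 ≤ topEigenvalue T := by
  have := Real.sqrt_nonneg (T ^ 2 - 4)
  rw [topEigenvalue]; linarith

theorem topEigenvalue_le {T : ℝ} (hT : 2 ≤ T) : topEigenvalue T ≤ T := by
  have h := topEigenvalue_add_inv hT
  have : 0 < (topEigenvalue T)⁻¹ := inv_pos.2 (by linarith [one_le_topEigenvalue hT])
  linarith

/-- The slope of the affine function that agrees with `x ↦ x ^ t` at `m` and `m⁻¹`. -/
noncomputable def powSlope (m t : ℝ) : ℝ := (m ^ t - m⁻¹ ^ t) / (m - m⁻¹)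

theorem inv_rpow_eq_powSlope {m : ℝ} (hm : 1 ≤ m) (t : ℝ) :
    m⁻¹ ^ t = powSlope m t * m⁻¹ + (m ^ t - powSlope m t * m) := by
  rcases hm.eq_or_lt with rfl | hm
  -- At `m = 1` the slope is `0 / 0 = 0`, and both sides are `1`.
  · simp [powSlope]
  · have : m - m⁻¹ ≠ 0 := by
      have : m⁻¹ < 1 := inv_lt_one_of_one_lt₀ hm
      linarith
    have h : powSlope m t * (m - m⁻¹) = m ^ t - m⁻¹ ^ t := div_mul_cancel₀ _ this
    linarith

theorem mem_spectrum_gram {M : Matrix (Fin 2) (Fin 2) ℝ} (hM : M.det = 1) {x : ℝ}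
    (hx : x ∈ spectrum ℝ (M.transpose * M)) :
    x = topEigenvalue (frobSq M) ∨ x = (topEigenvalue (frobSq M))⁻¹ := by
  have h2 := two_le_frobSq hM
  have h1 := one_le_topEigenvalue h2
  have h := topEigenvalue_add_inv h2
  have hd : (M.transpose * M).det = 1 := by simp [hM]
  rw [Matrix.mem_spectrum_iff_isRoot_charpoly, Polynomial.IsRoot.def, Matrix.charpoly_fin_two] at hx
  simp only [Polynomial.eval_add, Polynomial.eval_sub, Polynomial.eval_mul, Polynomial.eval_pow,
    Polynomial.eval_X, Polynomial.eval_C, hd] at hx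
  change x ^ 2 - frobSq M * x + 1 = 0 at hx
  rw [← h] at hx
  have : (x - topEigenvalue (frobSq M)) * (x - (topEigenvalue (frobSq M))⁻¹) = 0 := by
    have := mul_inv_cancel₀ (show topEigenvalue (frobSq M) ≠ 0 by linarith)
    linear_combination hx + this
  rcases mul_eq_zero.1 this with h | h
  · left; linarith
  · right; linarith

/-- The functional calculus sees only the values on the spectrum, contained in `{m, m⁻¹}`, so `x ^
t` may be replaced by its affine interpolant there. -/
theorem gramPow_eq_affine {M : Matrix (Fin 2) (Fin 2) ℝ} (hM : M.det = 1) (t : ℝ) :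
    gramPow M t = powSlope (topEigenvalue (frobSq M)) t • (M.transpose * M) +
      (topEigenvalue (frobSq M) ^ t -
        powSlope (topEigenvalue (frobSq M)) t * topEigenvalue (frobSq M)) •
        (1 : Matrix (Fin 2) (Fin 2) ℝ) := by
  have hsa : IsSelfAdjoint (M.transpose * M) := by
    have := Matrix.isHermitian_conjTranspose_mul_self M
    rwa [Matrix.conjTranspose_eq_transpose_of_trivial] at this
  set m := topEigenvalue (frobSq M)
  have h1 : 1 ≤ m := one_le_topEigenvalue (two_le_frobSq hM)
  rw [gramPow, cfc_congr (g := fun x => powSlope m t * x + (m ^ t - powSlope m t * m)),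
    cfc_add_const _ _ _ (by fun_prop) hsa, cfc_const_mul_id _ _ hsa, Algebra.algebraMap_eq_smul_one]
  intro x hx
  rcases mem_spectrum_gram hM hx with rfl | rfl
  · simp only [m]; ring
  · exact inv_rpow_eq_powSlope h1 t

theorem gramPow_trace {M : Matrix (Fin 2) (Fin 2) ℝ} (hM : M.det = 1) (t : ℝ) :
    (gramPow M t).trace =
      topEigenvalue (frobSq M) ^ t + (topEigenvalue (frobSq M))⁻¹ ^ t := by
  have h2 := two_le_frobSq hM
  have h := topEigenvalue_add_inv h2
  rw [gramPow_eq_affine hM, inv_rpow_eq_powSlope (one_le_topEigenvalue h2)]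
  simp only [Matrix.trace_add, Matrix.trace_smul, Matrix.trace_one, smul_eq_mul, Fintype.card_fin]
  rw [← frobSq]
  push_cast
  linear_combination -powSlope (topEigenvalue (frobSq M)) t * h

/-- With `d = m ^ t - c * m`, `det (c G + d) = (c m + d) (c m⁻¹ + d)`, and the factors are `m ^ t`
and `m⁻¹ ^ t`. -/
theorem gramPow_det {M : Matrix (Fin 2) (Fin 2) ℝ} (hM : M.det = 1) (t : ℝ) :
    (gramPow M t).det = 1 := by
  have h2 := two_le_frobSq hM
  have h1 := one_le_topEigenvalue h2
  have h := topEigenvalue_add_inv h2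
  have hd : (M.transpose * M).det = 1 := by simp [hM]
  have ht : (M.transpose * M).trace = frobSq M := rfl
  rw [gramPow_eq_affine hM]
  have hi := inv_rpow_eq_powSlope h1 t
  set m := topEigenvalue (frobSq M)
  have hm : m * m⁻¹ = 1 := mul_inv_cancel₀ (by linarith)
  have hp : m ^ t * m⁻¹ ^ t = 1 := by
    rw [← Real.mul_rpow (by linarith) (inv_nonneg.2 (by linarith)), hm, Real.one_rpow]
  generalize hG : M.transpose * M = G at hd ht
  rw [Matrix.det_fin_two] at hd ⊢
  rw [Matrix.trace_fin_two] at ht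
  rw [hi] at hp
  simp only [Matrix.add_apply, Matrix.smul_apply, smul_eq_mul, Matrix.one_apply_eq, mul_one, ne_eq,
    zero_ne_one, one_ne_zero, not_false_eq_true, Matrix.one_apply_ne, mul_zero, add_zero]
  generalize powSlope m t = c at hp ⊢
  rw [← h] at ht
  linear_combination hp + c ^ 2 * hd + c * (m ^ t - c * m) * ht - c ^ 2 * hm

theorem gramPow_symm {M : Matrix (Fin 2) (Fin 2) ℝ} (hM : M.det = 1) (t : ℝ) :
    (gramPow M t).transpose = gramPow M t := by
  simp [gramPow_eq_affine hM]

/-! ### Inverse transposes as conjugates by `J` -/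

theorem symplJ_inv : symplJ⁻¹ = !![0, -1; 1, 0] := by
  rw [symplJ, Matrix.inv_def]
  simp [Matrix.det_fin_two, Matrix.adjugate_fin_two]

theorem tilde_eq {M : Matrix (Fin 2) (Fin 2) ℝ} (hM : M.det = 1) :
    tilde M = symplJ * M * symplJ⁻¹ := by
  rw [symplJ_inv, tilde, Matrix.inv_def, Matrix.det_transpose, hM, symplJ, Matrix.adjugate_fin_two]
  ext i j
  fin_cases i <;> fin_cases j <;> simp [Matrix.mul_apply, Matrix.vecMul, dotProduct, Fin.sum_univ_two]

theorem symplJ_mul_inv : symplJ * symplJ⁻¹ = 1 :=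
  Matrix.mul_nonsing_inv _ (by simp [symplJ, Matrix.det_fin_two])

theorem symplJ_inv_mul : symplJ⁻¹ * symplJ = 1 :=
  Matrix.nonsing_inv_mul _ (by simp [symplJ, Matrix.det_fin_two])

theorem symplJ_transpose : symplJ.transpose = symplJ⁻¹ := by
  rw [symplJ_inv, symplJ]
  ext i j
  fin_cases i <;> fin_cases j <;> simp

theorem tilde_gram {M : Matrix (Fin 2) (Fin 2) ℝ} (hM : M.det = 1) :
    (tilde M).transpose * tilde M = symplJ * (M.transpose * M) * symplJ⁻¹ := by
  have h : symplJ⁻¹.transpose = symplJ := by rw [← symplJ_transpose, Matrix.transpose_transpose]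
  rw [tilde_eq hM, Matrix.transpose_mul, Matrix.transpose_mul, symplJ_transpose, h]
  simp only [Matrix.mul_assoc]
  rw [← Matrix.mul_assoc symplJ⁻¹ symplJ, symplJ_inv_mul, Matrix.one_mul]

theorem tilde_frobSq {M : Matrix (Fin 2) (Fin 2) ℝ} (hM : M.det = 1) :
    frobSq (tilde M) = frobSq M := by
  rw [frobSq, tilde_gram hM, Matrix.trace_mul_comm, ← Matrix.mul_assoc, symplJ_inv_mul,
    Matrix.one_mul, frobSq]

theorem tilde_det {M : Matrix (Fin 2) (Fin 2) ℝ} (hM : M.det = 1) : (tilde M).det = 1 := by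
  simp [tilde, Matrix.det_nonsing_inv, hM]

theorem gramPow_tilde {M : Matrix (Fin 2) (Fin 2) ℝ} (hM : M.det = 1) (t : ℝ) :
    gramPow (tilde M) t = symplJ * gramPow M t * symplJ⁻¹ := by
  rw [gramPow_eq_affine (tilde_det hM), gramPow_eq_affine hM, tilde_frobSq hM, tilde_gram hM]
  simp [Matrix.mul_add, Matrix.add_mul, symplJ_mul_inv]

theorem tilde_tilde {M : Matrix (Fin 2) (Fin 2) ℝ} (hM : M.det = 1) : tilde (tilde M) = M := by
  rw [tilde, tilde, Matrix.transpose_nonsing_inv, Matrix.transpose_transpose,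
    Matrix.nonsing_inv_nonsing_inv _ (by simp [hM])]

theorem tilde_mul (M N : Matrix (Fin 2) (Fin 2) ℝ) : tilde (M * N) = tilde M * tilde N := by
  rw [tilde, Matrix.transpose_mul, Matrix.mul_inv_rev, tilde, tilde]

theorem cocycle_tilde (A : Fin 2 → Matrix (Fin 2) (Fin 2) ℝ) (ω : ℕ → Fin 2) (n : ℕ) :
    cocycle (fun i => tilde (A i)) ω n = tilde (cocycle A ω n) := by
  induction n with
  | zero => simp [cocycle, tilde]
  | succ n ih => rw [cocycle, cocycle, ih, tilde_mul]

theorem cocycle_det {A : Fin 2 → Matrix (Fin 2) (Fin 2) ℝ} (hA : ∀ i, (A i).det = 1)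
    (ω : ℕ → Fin 2) (n : ℕ) : (cocycle A ω n).det = 1 := by
  induction n with
  | zero => simp [cocycle]
  | succ n ih => rw [cocycle, Matrix.det_mul, ih, hA, one_mul]

theorem IsOseledetsLimit.det_eq_one {M : ℕ → Matrix (Fin 2) (Fin 2) ℝ} (hM : ∀ n, (M n).det = 1)
    {Λ : Matrix (Fin 2) (Fin 2) ℝ} (h : IsOseledetsLimit M Λ) : Λ.det = 1 := by
  have h1 : Tendsto (fun n : ℕ => (gramPow (M n) (1 / (2 * (n : ℝ)))).det) atTop (𝓝 Λ.det) :=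
    ((continuous_id.matrix_det).tendsto Λ).comp h
  simp only [gramPow_det (hM _)] at h1
  exact (tendsto_nhds_unique h1 tendsto_const_nhds)

theorem IsOseledetsLimit.transpose_eq {M : ℕ → Matrix (Fin 2) (Fin 2) ℝ}
    (hM : ∀ n, (M n).det = 1) {Λ : Matrix (Fin 2) (Fin 2) ℝ} (h : IsOseledetsLimit M Λ) :
    Λ.transpose = Λ := by
  have h1 : Tendsto (fun n : ℕ => (gramPow (M n) (1 / (2 * (n : ℝ)))).transpose) atTop
      (𝓝 Λ.transpose) := ((continuous_id.matrix_transpose).tendsto Λ).comp h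
  simp only [gramPow_symm (hM _)] at h1
  exact (tendsto_nhds_unique h1 h)

theorem IsOseledetsLimit.tilde {M : ℕ → Matrix (Fin 2) (Fin 2) ℝ} (hM : ∀ n, (M n).det = 1)
    {Λ : Matrix (Fin 2) (Fin 2) ℝ} (h : IsOseledetsLimit M Λ) :
    IsOseledetsLimit (fun n => tilde (M n)) (symplJ * Λ * symplJ⁻¹) := by
  unfold IsOseledetsLimit
  simp only [gramPow_tilde (hM _)]
  exact (((continuous_const.matrix_mul continuous_id).matrix_mul
    continuous_const).tendsto Λ).comp h

theorem conj_symplJ_eq_inv {Λ : Matrix (Fin 2) (Fin 2) ℝ} (hd : Λ.det = 1)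
    (hs : Λ.transpose = Λ) : symplJ * Λ * symplJ⁻¹ = Λ⁻¹ := by
  rw [← tilde_eq hd, tilde, hs]

theorem hasEigenvalue_conj_symplJ {Λ : Matrix (Fin 2) (Fin 2) ℝ} {x : ℝ}
    (h : Module.End.HasEigenvalue (Matrix.toLin' Λ) x) :
    Module.End.HasEigenvalue (Matrix.toLin' (symplJ * Λ * symplJ⁻¹)) x := by
  rw [Module.End.hasEigenvalue_iff_mem_spectrum, Matrix.spectrum_toLin'] at h ⊢
  rw [Matrix.mem_spectrum_iff_isRoot_charpoly] at h ⊢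
  rwa [Matrix.charpoly_mul_comm, ← Matrix.mul_assoc, symplJ_inv_mul, Matrix.one_mul]

theorem lyapunovExponents_subset_tilde {M : ℕ → Matrix (Fin 2) (Fin 2) ℝ}
    (hM : ∀ n, (M n).det = 1) :
    lyapunovExponents M ⊆ lyapunovExponents (fun n => tilde (M n)) := by
  rintro χ ⟨Λ, h, he⟩
  exact ⟨_, h.tilde hM, hasEigenvalue_conj_symplJ he⟩

theorem norm_toEuclideanLin_symplJ (x : EuclideanSpace ℝ (Fin 2)) :
    ‖Matrix.toEuclideanLin symplJ x‖ = ‖x‖ := by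
  rw [EuclideanSpace.norm_eq, EuclideanSpace.norm_eq]
  congr 1
  simp [Matrix.toLpLin_apply, symplJ, Fin.sum_univ_two, dotProduct]
  ring

theorem toEuclideanLin_mul_apply (M N : Matrix (Fin 2) (Fin 2) ℝ)
    (x : EuclideanSpace ℝ (Fin 2)) :
    Matrix.toEuclideanLin (M * N) x = Matrix.toEuclideanLin M (Matrix.toEuclideanLin N x) := by
  simp [Matrix.toLpLin_apply]

theorem growthRates_subset_tilde {M : ℕ → Matrix (Fin 2) (Fin 2) ℝ}
    (hM : ∀ n, (M n).det = 1) :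
    growthRates M ⊆ growthRates (fun n => tilde (M n)) := by
  rintro χ ⟨x, hx, h⟩
  refine ⟨Matrix.toEuclideanLin symplJ x, fun h0 => hx ?_, ?_⟩
  · rwa [← norm_eq_zero, norm_toEuclideanLin_symplJ, norm_eq_zero] at h0
  · have h1 (n : ℕ) : ‖Matrix.toEuclideanLin (tilde (M n)) (Matrix.toEuclideanLin symplJ x)‖ =
        ‖Matrix.toEuclideanLin (M n) x‖ := by
      rw [tilde_eq (hM n), ← toEuclideanLin_mul_apply, Matrix.mul_assoc, symplJ_inv_mul,
        Matrix.mul_one, toEuclideanLin_mul_apply, norm_toEuclideanLin_symplJ]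
    simpa only [h1] using h

/-! ### Convergence of the Gram matrices divided by their traces -/

/-- The left side is the polarization of `det` on symmetric matrices, taken at `Mᵀ 1 M` and `Mᵀ (Bᵀ
B) M`. Congruence by `M` multiplies it by `(det M) ^ 2 = 1`, and at `1` and `Bᵀ B` it is the trace
of `Bᵀ B`. -/
theorem gram_cross_eq_frobSq {M : Matrix (Fin 2) (Fin 2) ℝ} (hM : M.det = 1)
    (B : Matrix (Fin 2) (Fin 2) ℝ) :
    (M.transpose * M) 0 0 * ((B * M).transpose * (B * M)) 1 1 +
      (M.transpose * M) 1 1 * ((B * M).transpose * (B * M)) 0 0 -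
      2 * (M.transpose * M) 0 1 * ((B * M).transpose * (B * M)) 0 1 = frobSq B := by
  rw [Matrix.det_fin_two] at hM
  have : frobSq B = (M 0 0 * M 1 1 - M 0 1 * M 1 0) ^ 2 * frobSq B := by rw [hM]; ring
  rw [this, frobSq_eq]
  simp only [Matrix.mul_apply, Matrix.transpose_apply, Fin.sum_univ_two]
  ring

theorem gram_symm (M : Matrix (Fin 2) (Fin 2) ℝ) :
    (M.transpose * M) 1 0 = (M.transpose * M) 0 1 := by
  simp only [Matrix.mul_apply, Matrix.transpose_apply, Fin.sum_univ_two]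
  ring

/-- Both normalized matrices have trace `1`, so their difference is symmetric and traceless, and the
left side is minus its determinant. Polarization turns this into `frobSq B / (T T') - 1 / T ^ 2 - 1
/ T' ^ 2`. -/
theorem gram_diff_sq_le {M B : Matrix (Fin 2) (Fin 2) ℝ} (hM : M.det = 1) (hB : B.det = 1) :
    ((frobSq M)⁻¹ * (M.transpose * M) 0 0 -
        (frobSq (B * M))⁻¹ * ((B * M).transpose * (B * M)) 0 0) ^ 2 +
      ((frobSq M)⁻¹ * (M.transpose * M) 0 1 -
        (frobSq (B * M))⁻¹ * ((B * M).transpose * (B * M)) 0 1) ^ 2 ≤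
      frobSq B / (frobSq M * frobSq (B * M)) := by
  have hBM : (B * M).det = 1 := by simp [hM, hB]
  have hT := two_le_frobSq hM
  have hT' := two_le_frobSq hBM
  have hx := gram_cross_eq_frobSq hM B
  have e1 : frobSq M = (M.transpose * M) 0 0 + (M.transpose * M) 1 1 := Matrix.trace_fin_two _
  have e2 : frobSq (B * M) = ((B * M).transpose * (B * M)) 0 0 +
    ((B * M).transpose * (B * M)) 1 1 := Matrix.trace_fin_two _
  have d1 : (M.transpose * M).det = 1 := by simp [hM]
  have d2 : ((B * M).transpose * (B * M)).det = 1 := by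
    rw [Matrix.det_mul, Matrix.det_transpose, hBM, one_mul]
  rw [Matrix.det_fin_two, gram_symm] at d1 d2
  generalize M.transpose * M = G at *
  generalize (B * M).transpose * (B * M) = G' at *
  generalize frobSq M = T at *
  generalize frobSq (B * M) = T' at *
  have key : (T⁻¹ * G 0 0 - T'⁻¹ * G' 0 0) ^ 2 + (T⁻¹ * G 0 1 - T'⁻¹ * G' 0 1) ^ 2 =
      frobSq B / (T * T') - 1 / T ^ 2 - 1 / T' ^ 2 := by
    field_simp
    rw [← hx]
    have c1 : T' ^ 2 = T' ^ 2 * (G 0 0 * G 1 1 - G 0 1 * G 0 1) := by rw [d1, mul_one]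
    have c2 : T ^ 2 = T ^ 2 * (G' 0 0 * G' 1 1 - G' 0 1 * G' 0 1) := by rw [d2, mul_one]
    subst e1 e2
    linear_combination c1 + c2
  rw [key]
  have : 0 ≤ 1 / T ^ 2 := by positivity
  have : 0 ≤ 1 / T' ^ 2 := by positivity
  linarith

theorem exists_tendsto_of_abs_sub_succ_le {a T : ℕ → ℝ} {β c : ℝ} (hβ : 0 ≤ β) (hc : 0 < c)
    (hT : ∀ᶠ n : ℕ in atTop, Real.exp (c * (n : ℝ)) ≤ T n)
    (ha : ∀ n, (a n - a (n + 1)) ^ 2 ≤ β / (T n * T (n + 1))) :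
    ∃ l, Tendsto a atTop (𝓝 l) := by
  refine cauchySeq_tendsto_of_complete (cauchySeq_of_summable_dist ?_)
  -- The increments are eventually dominated by this geometric series; the extra decay of `T (n +
  -- 1)` over `T n` is discarded.
  have hs : Summable fun n : ℕ => √β * Real.exp (-c) ^ n :=
    (summable_geometric_of_lt_one (Real.exp_pos _).le (by simpa using hc)).mul_left _
  refine hs.of_norm_bounded_eventually_nat ?_
  filter_upwards [hT, (tendsto_add_atTop_nat 1).eventually hT] with n h1 h2
  rw [Real.norm_of_nonneg dist_nonneg, Real.dist_eq]
  refine abs_le_of_sq_le_sq ?_ (by positivity)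
  have h3 : Real.exp (c * (n : ℝ)) ≤ Real.exp (c * ((n + 1 : ℕ) : ℝ)) := by
    gcongr; simp
  have h4 : Real.exp (c * (n : ℝ)) * Real.exp (c * (n : ℝ)) ≤ T n * T (n + 1) := by
    exact mul_le_mul h1 (h3.trans h2) (Real.exp_pos _).le ((Real.exp_pos _).le.trans h1)
  calc (a n - a (n + 1)) ^ 2 ≤ β / (T n * T (n + 1)) := ha n
    _ ≤ β / (Real.exp (c * (n : ℝ)) * Real.exp (c * (n : ℝ))) := by gcongr
    _ = (√β * Real.exp (-c) ^ n) ^ 2 := by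
      rw [mul_pow, Real.sq_sqrt hβ, ← Real.exp_nat_mul, div_eq_mul_inv, ← Real.exp_add,
        ← Real.exp_neg, ← Real.exp_nat_mul]
      congr 2
      push_cast
      ring

theorem exists_tendsto_normalized_gram {M B : ℕ → Matrix (Fin 2) (Fin 2) ℝ} {β c : ℝ}
    (hM : ∀ n, (M n).det = 1) (hB : ∀ n, (B n).det = 1) (hBβ : ∀ n, frobSq (B n) ≤ β)
    (hMB : ∀ n, M (n + 1) = B n * M n) (hc : 0 < c)
    (hT : ∀ᶠ n : ℕ in atTop, Real.exp (c * (n : ℝ)) ≤ frobSq (M n)) :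
    ∃ H, Tendsto (fun n => (frobSq (M n))⁻¹ • ((M n).transpose * M n)) atTop (𝓝 H) := by
  have hpos (n : ℕ) : 0 < frobSq (M n) := by linarith [two_le_frobSq (hM n)]
  have hβ : 0 ≤ β := by linarith [two_le_frobSq (hB 0), hBβ 0]
  have hle (n : ℕ) : frobSq (B n) / (frobSq (M n) * frobSq (M (n + 1))) ≤
      β / (frobSq (M n) * frobSq (M (n + 1))) :=
    div_le_div_of_nonneg_right (hBβ n) (mul_pos (hpos n) (hpos _)).le
  have hd (n : ℕ) := gram_diff_sq_le (hM n) (hB n)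
  simp only [← hMB] at hd
  obtain ⟨l₀, h0⟩ := exists_tendsto_of_abs_sub_succ_le hβ hc hT
    (a := fun n => (frobSq (M n))⁻¹ * ((M n).transpose * M n) 0 0)
    (fun n => (le_add_of_nonneg_right (sq_nonneg _)).trans ((hd n).trans (hle n)))
  obtain ⟨l₁, h1⟩ := exists_tendsto_of_abs_sub_succ_le hβ hc hT
    (a := fun n => (frobSq (M n))⁻¹ * ((M n).transpose * M n) 0 1)
    (fun n => (le_add_of_nonneg_left (sq_nonneg _)).trans ((hd n).trans (hle n)))
  -- Symmetry and trace `1` determine the limit from its first row.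
  refine ⟨!![l₀, l₁; l₁, 1 - l₀], tendsto_pi_nhds.2 fun i => tendsto_pi_nhds.2 fun j => ?_⟩
  fin_cases i <;> fin_cases j
  · simpa using h0
  · simpa using h1
  · simpa [gram_symm] using h1
  · have h2 (n : ℕ) : (frobSq (M n))⁻¹ * ((M n).transpose * M n) 1 1 =
        1 - (frobSq (M n))⁻¹ * ((M n).transpose * M n) 0 0 := by
      have e : frobSq (M n) = ((M n).transpose * M n) 0 0 + ((M n).transpose * M n) 1 1 :=
        Matrix.trace_fin_two _
      have := inv_mul_cancel₀ (hpos n).ne'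
      linear_combination this - (frobSq (M n))⁻¹ * e
    simpa [h2] using h0.const_sub 1

/-! ### From the growth of the trace to the limit `Λ` -/

theorem tendsto_log_topEigenvalue_div {T : ℕ → ℝ} {L : ℝ} (hT : ∀ n, 2 ≤ T n)
    (h : Tendsto (fun n : ℕ => Real.log (T n) / n) atTop (𝓝 L)) :
    Tendsto (fun n : ℕ => Real.log (topEigenvalue (T n)) / n) atTop (𝓝 L) := by
  have h0 : Tendsto (fun n : ℕ => Real.log (T n) / n - Real.log 2 / n) atTop (𝓝 L) := by
    simpa using h.sub (tendsto_const_div_atTop_nhds_zero_nat (Real.log 2))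
  refine tendsto_of_tendsto_of_tendsto_of_le_of_le h0 h (fun n => ?_) (fun n => ?_)
  · have hp : 0 < T n := by linarith [hT n]
    simp only
    rw [← sub_div, ← Real.log_div hp.ne' two_ne_zero]
    gcongr
    exact half_le_topEigenvalue _
  · have := one_le_topEigenvalue (hT n)
    simp only
    gcongr
    exact topEigenvalue_le (hT n)

theorem tendsto_topEigenvalue_rpow {T : ℕ → ℝ} {L : ℝ} (hT : ∀ n, 2 ≤ T n)
    (h : Tendsto (fun n : ℕ => Real.log (T n) / n) atTop (𝓝 L)) :
    Tendsto (fun n : ℕ => topEigenvalue (T n) ^ (1 / (2 * (n : ℝ)))) atTop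
      (𝓝 (Real.exp (L / 2))) := by
  have h1 := (Real.continuous_exp.tendsto _).comp
    ((tendsto_log_topEigenvalue_div hT h).div_const 2)
  refine h1.congr fun n => ?_
  rw [Real.rpow_def_of_pos (by linarith [one_le_topEigenvalue (hT n)])]
  simp only [Function.comp]
  congr 1
  ring

theorem tendsto_topEigenvalue_inv_rpow {T : ℕ → ℝ} {L : ℝ} (hT : ∀ n, 2 ≤ T n)
    (h : Tendsto (fun n : ℕ => Real.log (T n) / n) atTop (𝓝 L)) :
    Tendsto (fun n : ℕ => (topEigenvalue (T n))⁻¹ ^ (1 / (2 * (n : ℝ)))) atTop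
      (𝓝 (Real.exp (L / 2))⁻¹) := by
  refine ((tendsto_topEigenvalue_rpow hT h).inv₀ (Real.exp_pos _).ne').congr fun n => ?_
  rw [Real.inv_rpow (by linarith [one_le_topEigenvalue (hT n)])]

/-- For a symmetric matrix with diagonal `a, d`, off-diagonal entry `b` and determinant `1`, `trace
^ 2 - 4 = (a - d) ^ 2 + (2 b) ^ 2`; so trace tending to `2` forces convergence to the identity. -/
theorem isOseledetsLimit_one_of_tendsto_zero {M : ℕ → Matrix (Fin 2) (Fin 2) ℝ}
    (hM : ∀ n, (M n).det = 1)
    (h : Tendsto (fun n : ℕ => Real.log (frobSq (M n)) / n) atTop (𝓝 0)) :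
    IsOseledetsLimit M 1 := by
  have hT (n : ℕ) := two_le_frobSq (hM n)
  have htr : Tendsto (fun n : ℕ => (gramPow (M n) (1 / (2 * (n : ℝ)))).trace) atTop (𝓝 2) := by
    simp only [gramPow_trace (hM _)]
    convert (tendsto_topEigenvalue_rpow hT h).add (tendsto_topEigenvalue_inv_rpow hT h) using 2
    norm_num
  unfold IsOseledetsLimit
  have hd (n : ℕ) := gramPow_det (hM n) (1 / (2 * (n : ℝ)))
  have hs (n : ℕ) : gramPow (M n) (1 / (2 * (n : ℝ))) 1 0 =
      gramPow (M n) (1 / (2 * (n : ℝ))) 0 1 :=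
    congrFun (congrFun (gramPow_symm (hM n) (1 / (2 * (n : ℝ)))) 0) 1
  simp only [Matrix.det_fin_two, hs] at hd
  generalize hP : (fun n : ℕ => gramPow (M n) (1 / (2 * (n : ℝ)))) = P
  have hP' (n : ℕ) : gramPow (M n) (1 / (2 * (n : ℝ))) = P n := by rw [← hP]
  simp only [hP', Matrix.trace_fin_two] at htr hd hs
  have hq : Tendsto (fun n => √((P n 0 0 + P n 1 1) ^ 2 - 4)) atTop (𝓝 0) := by
    have : Tendsto (fun n => √((P n 0 0 + P n 1 1) ^ 2 - 4)) atTop (𝓝 √((2 : ℝ) ^ 2 - 4)) :=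
      ((htr.pow 2).sub_const 4).sqrt
    convert this using 2
    norm_num
  have hsq (n : ℕ) : (P n 0 0 + P n 1 1) ^ 2 - 4 =
      (P n 0 0 - P n 1 1) ^ 2 + (2 * P n 0 1) ^ 2 := by linear_combination 4 * hd n
  have h1 : Tendsto (fun n => P n 0 0 - P n 1 1) atTop (𝓝 0) :=
    squeeze_zero_norm (fun n => Real.abs_le_sqrt (by rw [hsq]; nlinarith)) hq
  have h2 : Tendsto (fun n => 2 * P n 0 1) atTop (𝓝 0) :=
    squeeze_zero_norm (fun n => Real.abs_le_sqrt (by rw [hsq]; nlinarith)) hq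
  have h3 : Tendsto (fun n => P n 0 1) atTop (𝓝 0) := by simpa using h2.div_const 2
  refine tendsto_pi_nhds.2 fun i => tendsto_pi_nhds.2 fun j => ?_
  fin_cases i <;> fin_cases j
  · have := (htr.add h1).div_const 2
    norm_num at this
    exact this
  · simpa using h3
  · simpa [hs] using h3
  · have := (htr.sub h1).div_const 2
    norm_num at this
    simpa using this

theorem tendsto_topEigenvalue_inv {T : ℕ → ℝ} (h : Tendsto T atTop atTop) :
    Tendsto (fun n => (topEigenvalue (T n))⁻¹) atTop (𝓝 0) :=
  tendsto_inv_atTop_zero.comp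
    (tendsto_atTop_mono (fun n => half_le_topEigenvalue (T n)) (h.atTop_div_const two_pos))

/-- For `L > 0`, with `s` the slope, the power is `(s T) • (G / T) + (m ^ t - s m) • 1`. Although
`T` and `m` diverge, `s m = (m ^ t - m⁻¹ ^ t) / (1 - m⁻¹ ^ 2)` and `s T = s m (1 + m⁻¹ ^ 2)`
converge. -/
theorem exists_isOseledetsLimit {M B : ℕ → Matrix (Fin 2) (Fin 2) ℝ} {β L : ℝ}
    (hM : ∀ n, (M n).det = 1) (hB : ∀ n, (B n).det = 1) (hBβ : ∀ n, frobSq (B n) ≤ β)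
    (hMB : ∀ n, M (n + 1) = B n * M n)
    (h : Tendsto (fun n : ℕ => Real.log (frobSq (M n)) / n) atTop (𝓝 L)) :
    ∃ Λ, IsOseledetsLimit M Λ := by
  have hT (n : ℕ) := two_le_frobSq (hM n)
  have hL : 0 ≤ L := ge_of_tendsto' h fun n =>
    div_nonneg (Real.log_nonneg (by linarith [hT n])) n.cast_nonneg
  rcases hL.eq_or_lt with rfl | hL
  · exact ⟨1, isOseledetsLimit_one_of_tendsto_zero hM h⟩
  have hexp : ∀ᶠ n : ℕ in atTop, Real.exp (L / 2 * (n : ℝ)) ≤ frobSq (M n) := by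
    filter_upwards [h.eventually_const_le (half_lt_self hL), eventually_gt_atTop 0] with n h1 h2
    rw [le_div_iff₀ (by exact_mod_cast h2)] at h1
    exact (Real.le_log_iff_exp_le (by linarith [hT n])).1 h1
  obtain ⟨H, hH⟩ := exists_tendsto_normalized_gram hM hB hBβ hMB (half_pos hL) hexp
  have hTop : Tendsto (fun n => frobSq (M n)) atTop atTop :=
    tendsto_atTop_mono' _ hexp (Real.tendsto_exp_atTop.comp
      (tendsto_natCast_atTop_atTop.const_mul_atTop (half_pos hL)))
  have hi := tendsto_topEigenvalue_inv hTop
  have hr := tendsto_topEigenvalue_rpow hT h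
  have hr' := tendsto_topEigenvalue_inv_rpow hT h
  have hden : Tendsto (fun n => 1 - (topEigenvalue (frobSq (M n)))⁻¹ ^ 2) atTop (𝓝 1) := by
    simpa using (hi.pow 2).const_sub 1
  have hslope : Tendsto (fun n : ℕ => powSlope (topEigenvalue (frobSq (M n)))
      (1 / (2 * (n : ℝ))) * topEigenvalue (frobSq (M n))) atTop
      (𝓝 (Real.exp (L / 2) - (Real.exp (L / 2))⁻¹)) := by
    have := (hr.sub hr').div hden one_ne_zero
    rw [div_one] at this
    refine this.congr fun n => ?_
    simp only [Pi.div_apply]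
    have := one_le_topEigenvalue (hT n)
    generalize topEigenvalue (frobSq (M n)) = m at this ⊢
    have hm : m ≠ 0 := by linarith
    have e : m - m⁻¹ = m * (1 - m⁻¹ ^ 2) := by field_simp
    rw [powSlope, e, div_mul_eq_mul_div, mul_comm m (1 - m⁻¹ ^ 2), mul_div_mul_right _ _ hm]
  have hslopeT : Tendsto (fun n : ℕ => powSlope (topEigenvalue (frobSq (M n)))
      (1 / (2 * (n : ℝ))) * frobSq (M n)) atTop
      (𝓝 (Real.exp (L / 2) - (Real.exp (L / 2))⁻¹)) := by
    have h1 : Tendsto (fun n => 1 + (topEigenvalue (frobSq (M n)))⁻¹ ^ 2) atTop (𝓝 1) := by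
      simpa using (hi.pow 2).const_add 1
    have := hslope.mul h1
    rw [mul_one] at this
    refine this.congr fun n => ?_
    have h1 := one_le_topEigenvalue (hT n)
    have h2 := topEigenvalue_add_inv (hT n)
    have hm : topEigenvalue (frobSq (M n)) ≠ 0 := by linarith
    generalize powSlope (topEigenvalue (frobSq (M n))) (1 / (2 * (n : ℝ))) = s
    conv_rhs => rw [← h2]
    field_simp
  refine ⟨_, ((hslopeT.smul hH).add
    ((hr.sub hslope).smul_const (1 : Matrix (Fin 2) (Fin 2) ℝ))).congr fun n => ?_⟩
  have h0 : frobSq (M n) ≠ 0 := by linarith [hT n]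
  rw [gramPow_eq_affine (hM n), smul_smul, mul_assoc, mul_inv_cancel₀ h0, mul_one]

/-! ### A subadditive ergodic theorem -/

/-- A Katznelson–Weiss covering estimate: a subadditive process is bounded along each orbit in
terms of the visits to the set where it stays above `ℓ + ε` for `N` steps. -/
theorem subadditive_process_le_of_visits {Ω : Type*} {τ : Ω → Ω} {u : ℕ → Ω → ℝ} {ℓ : Ω → ℝ}
    {C ε : ℝ} (hC : 0 ≤ C) (hu : ∀ n ω, u n ω ≤ C * (n + 1))
    (hsub : ∀ m n ω, u (m + n) ω ≤ u m ω + u n (τ^[m] ω))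
    (hℓ : ∀ ω, 0 ≤ ℓ ω) (hℓτ : ∀ ω, ℓ (τ ω) ≤ ℓ ω) (hε : 0 ≤ ε) (N M : ℕ) (ω : Ω) :
    u M ω ≤ M * (ℓ ω + ε) + 2 * C * ∑ j ∈ Finset.range M,
      Set.indicator {ω | ∀ n, 1 ≤ n → n ≤ N → n * (ℓ ω + ε) < u n ω} (fun _ => (1 : ℝ)) (τ^[j] ω)
      + C * (N + 1) := by
  set B := {ω | ∀ n, 1 ≤ n → n ≤ N → n * (ℓ ω + ε) < u n ω} with hB
  have hind (ω : Ω) : 0 ≤ Set.indicator B (fun _ => (1 : ℝ)) ω :=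
    Set.indicator_nonneg (fun _ _ => zero_le_one) _
  have hiter (n : ℕ) (ω : Ω) : ℓ (τ^[n] ω) ≤ ℓ ω := by
    induction n with
    | zero => exact le_rfl
    | succ n ih => rw [Function.iterate_succ_apply']; exact (hℓτ _).trans ih
  induction M using Nat.strong_induction_on generalizing ω with
  | _ M ih =>
    by_cases hMN : M ≤ N
    · have h1 : (0 : ℝ) ≤ M * (ℓ ω + ε) := mul_nonneg M.cast_nonneg (add_nonneg (hℓ ω) hε)
      have h2 : 0 ≤ 2 * C * ∑ j ∈ Finset.range M, Set.indicator B (fun _ => (1 : ℝ)) (τ^[j] ω) :=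
        mul_nonneg (by linarith) (Finset.sum_nonneg fun _ _ => hind _)
      have h3 : C * ((M : ℝ) + 1) ≤ C * (N + 1) := by gcongr
      linarith [hu M ω]
    -- An initial segment with a good bound is split off and induction covers the rest of the orbit;
    -- `ℓ` does not increase along it, so the rate at `ω` still serves.
    · have step : ∀ n, 1 ≤ n → n ≤ M →
          u n ω ≤ n * (ℓ ω + ε) + 2 * C * ∑ j ∈ Finset.range n,
            Set.indicator B (fun _ => (1 : ℝ)) (τ^[j] ω) →
          u M ω ≤ M * (ℓ ω + ε) + 2 * C * ∑ j ∈ Finset.range M,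
            Set.indicator B (fun _ => (1 : ℝ)) (τ^[j] ω) + C * (N + 1) := by
        intro n h1 h2 h3
        obtain ⟨r, rfl⟩ := Nat.exists_eq_add_of_le h2
        have h4 := ih r (by omega) (τ^[n] ω)
        have h5 := hsub n r ω
        have h6 : (r : ℝ) * (ℓ (τ^[n] ω) + ε) ≤ r * (ℓ ω + ε) := by
          gcongr; exact hiter n ω
        rw [Finset.sum_range_add]
        simp only [← Function.iterate_add_apply] at h4
        have h7 (x : ℕ) : τ^[n + x] ω = τ^[x + n] ω := by rw [add_comm]
        simp only [h7]
        push_cast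
        linarith
      by_cases hω : ω ∈ B
      -- At a bad point one time step costs at most `u 1 ω ≤ 2 * C`, paid for by the indicator.
      · refine step 1 le_rfl (by omega) ?_
        have h1 := hu 1 ω
        have h2 := hℓ ω
        rw [Finset.sum_range_one, Function.iterate_zero_apply, Set.indicator_of_mem hω]
        push_cast at h1 ⊢
        linarith
      · simp only [hB, Set.mem_ofPred_eq, not_forall, not_lt] at hω
        obtain ⟨n, h1, h2, h3⟩ := hω
        refine step n h1 (by omega) (h3.trans (le_add_of_nonneg_right ?_))
        exact mul_nonneg (by linarith) (Finset.sum_nonneg fun _ _ => hind _)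

section SubadditiveErgodic

variable {Ω : Type*} {τ : Ω → Ω} {u : ℕ → Ω → ℝ} {C K : ℝ}

theorem div_le_of_le_mul_succ (hC : 0 ≤ C) (hu : ∀ n ω, u n ω ≤ C * (n + 1)) (n : ℕ) (ω : Ω) :
    u n ω / n ≤ 2 * C := by
  rcases n.eq_zero_or_pos with rfl | hn
  · simp; linarith
  · have h1 : (1 : ℝ) ≤ n := by exact_mod_cast hn
    rw [div_le_iff₀ (by linarith)]
    nlinarith [hu n ω]

theorem isCoboundedUnder_ge_div (hC : 0 ≤ C) (hu : ∀ n ω, u n ω ≤ C * (n + 1)) (ω : Ω) :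
    IsCoboundedUnder (· ≥ ·) atTop (fun n : ℕ => u n ω / n) :=
  (isBoundedUnder_of ⟨2 * C, fun n => div_le_of_le_mul_succ hC hu n ω⟩ :
    IsBoundedUnder (· ≤ ·) atTop (fun n : ℕ => u n ω / n)).isCoboundedUnder_ge

theorem isBoundedUnder_ge_div (h0 : ∀ n ω, 0 ≤ u n ω) (ω : Ω) :
    IsBoundedUnder (· ≥ ·) atTop (fun n : ℕ => u n ω / n) :=
  isBoundedUnder_of ⟨0, fun n => div_nonneg (h0 n ω) n.cast_nonneg⟩

/-- Discarding the first time step costs only the additive constant `K`, negligible after division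
by `n`. Monotonicity along orbits replaces invariance of the liminf. -/
theorem liminf_div_comp_le (hC : 0 ≤ C) (h0 : ∀ n ω, 0 ≤ u n ω)
    (hu : ∀ n ω, u n ω ≤ C * (n + 1)) (hK : ∀ n ω, u n (τ ω) ≤ u (n + 1) ω + K) (ω : Ω) :
    liminf (fun n : ℕ => u n (τ ω) / n) atTop ≤ liminf (fun n : ℕ => u n ω / n) atTop := by
  refine le_of_forall_gt_imp_ge_of_dense fun c hc => ?_
  obtain ⟨d, hd, hdc⟩ := exists_between hc
  have hfr := frequently_lt_of_liminf_lt (isCoboundedUnder_ge_div hC hu ω) hd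
  have hlim : Tendsto (fun n : ℕ => d + (d + K) / (n : ℝ)) atTop (𝓝 d) := by
    simpa using (tendsto_const_div_atTop_nhds_zero_nat (d + K)).const_add d
  have hev : ∀ᶠ n : ℕ in atTop, u (n + 1) ω / ((n + 1 : ℕ) : ℝ) < d → u n (τ ω) / n ≤ c := by
    filter_upwards [hlim.eventually_lt_const hdc, eventually_gt_atTop 0] with n h1 h2 h3
    have hn : (0 : ℝ) < n := by exact_mod_cast h2
    rw [div_lt_iff₀ (by positivity)] at h3
    refine le_trans ?_ h1.le
    rw [div_le_iff₀ hn, add_mul, div_mul_cancel₀ _ hn.ne']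
    push_cast at h3
    linarith [hK n ω]
  have hfr' : ∃ᶠ n : ℕ in atTop, u (n + 1) ω / ((n + 1 : ℕ) : ℝ) < d := by
    rw [← map_add_atTop_eq_nat 1] at hfr
    exact hfr
  exact liminf_le_of_frequently_le (hfr'.mp hev) (isBoundedUnder_ge_div h0 (τ ω))

variable [MeasurableSpace Ω] {μ : Measure Ω} [IsProbabilityMeasure μ]

/-- The lower bound in the subadditive ergodic theorem. -/
theorem le_integral_liminf_of_subadditive_process (hτ : MeasurePreserving τ μ μ)
    (hm : ∀ n, Measurable (u n)) (hC : 0 ≤ C) (h0 : ∀ n ω, 0 ≤ u n ω)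
    (hu : ∀ n ω, u n ω ≤ C * (n + 1))
    (hsub : ∀ m n ω, u (m + n) ω ≤ u m ω + u n (τ^[m] ω))
    (hK : ∀ n ω, u n (τ ω) ≤ u (n + 1) ω + K) {lam : ℝ}
    (hlam : ∀ n : ℕ, n * lam ≤ ∫ ω, u n ω ∂μ) :
    lam ≤ ∫ ω, liminf (fun n : ℕ => u n ω / n) atTop ∂μ := by
  set ℓ : Ω → ℝ := fun ω => liminf (fun n : ℕ => u n ω / n) atTop with hℓ
  have hℓm : Measurable ℓ := Measurable.liminf fun n => (hm n).div_const _
  have hℓ0 (ω : Ω) : 0 ≤ ℓ ω := le_liminf_of_le (isCoboundedUnder_ge_div hC hu ω)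
    (Eventually.of_forall fun n => div_nonneg (h0 n ω) n.cast_nonneg)
  have hℓC (ω : Ω) : ℓ ω ≤ 2 * C := liminf_le_of_frequently_le
    (Eventually.of_forall fun n => div_le_of_le_mul_succ hC hu n ω).frequently
    (isBoundedUnder_ge_div h0 ω)
  have hℓi : Integrable ℓ μ := .of_bound hℓm.aestronglyMeasurable (2 * C)
    (.of_forall fun ω => by rw [Real.norm_of_nonneg (hℓ0 ω)]; exact hℓC ω)
  have hui (n : ℕ) : Integrable (u n) μ := .of_bound (hm n).aestronglyMeasurable (C * (n + 1))
    (.of_forall fun ω => by rw [Real.norm_of_nonneg (h0 n ω)]; exact hu n ω)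
  have key : ∀ ε : ℝ, 0 < ε → lam ≤ ∫ ω, ℓ ω ∂μ + (1 + 2 * C) * ε := by
    intro ε hε
    let B : ℕ → Set Ω := fun N => {ω | ∀ n, 1 ≤ n → n ≤ N → n * (ℓ ω + ε) < u n ω}
    have hBm (N : ℕ) : MeasurableSet (B N) := by
      simp only [B, Set.ofPred_forall]
      exact .iInter fun n => .iInter fun _ => .iInter fun _ =>
        measurableSet_lt ((hℓm.add_const ε).const_mul _) (hm n)
    have hBanti : Antitone B := fun N N' h ω hω n h1 h2 => hω n h1 (h2.trans h)
    -- By definition of the liminf, `u n ω / n < ℓ ω + ε` for some `n > 0`, so every point leaves `B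
    -- N` eventually.
    have hBinter : ⋂ N, B N = ∅ := by
      refine Set.eq_empty_of_forall_notMem fun ω hω => ?_
      have hfr := frequently_lt_of_liminf_lt (isCoboundedUnder_ge_div hC hu ω)
        (lt_add_of_pos_right (ℓ ω) hε)
      obtain ⟨n, h1, h2⟩ := (hfr.and_eventually (eventually_gt_atTop 0)).exists
      have hn : (0 : ℝ) < n := by exact_mod_cast h2
      rw [div_lt_iff₀ hn, mul_comm] at h1
      exact absurd (Set.mem_iInter.1 hω n n h2 le_rfl) h1.not_gt
    have hBlim : Tendsto (fun N => μ.real (B N)) atTop (𝓝 0) := by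
      have := tendsto_measure_iInter_atTop (μ := μ) (fun N => (hBm N).nullMeasurableSet) hBanti
        ⟨0, measure_ne_top _ _⟩
      rw [hBinter, measure_empty] at this
      exact (ENNReal.tendsto_toReal ENNReal.zero_ne_top).comp this
    obtain ⟨N, hN⟩ := (hBlim.eventually_lt_const hε).exists
    have hindi (j : ℕ) : Integrable (fun ω => (B N).indicator (fun _ => (1 : ℝ)) (τ^[j] ω)) μ :=
      ((hτ.iterate j).integrable_comp_of_integrable
        ((integrable_const (1 : ℝ)).indicator (hBm N)))
    have hindv (j : ℕ) : ∫ ω, (B N).indicator (fun _ => (1 : ℝ)) (τ^[j] ω) ∂μ = μ.real (B N) := by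
      have hmi : Measurable ((B N).indicator (fun _ => (1 : ℝ))) :=
        measurable_const.indicator (hBm N)
      have := integral_map (hτ.iterate j).measurable.aemeasurable
        (hmi.aestronglyMeasurable (μ := μ.map τ^[j]))
      rw [(hτ.iterate j).map_eq] at this
      rw [← this, integral_indicator_const _ (hBm N), smul_eq_mul, mul_one]
    -- Integrating the covering estimate, each visit term has mean `μ.real (B N) < ε`, hence the
    -- factor `1 + 2 * C`. The last term vanishes after division by `M`.
    have hM (M : ℕ) : (M : ℝ) * lam ≤
        M * (∫ ω, ℓ ω ∂μ + (1 + 2 * C) * ε) + C * (N + 1) := by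
      have hi1 : Integrable (fun ω => M * (ℓ ω + ε)) μ :=
        (hℓi.add (integrable_const ε)).const_mul _
      have hi2 : Integrable (fun ω => 2 * C * ∑ j ∈ Finset.range M,
          (B N).indicator (fun _ => (1 : ℝ)) (τ^[j] ω)) μ :=
        (integrable_finsetSum _ fun j _ => hindi j).const_mul _
      have h1 : ∫ ω, u M ω ∂μ ≤ ∫ ω, (M * (ℓ ω + ε) + 2 * C * ∑ j ∈ Finset.range M,
          (B N).indicator (fun _ => (1 : ℝ)) (τ^[j] ω) + C * (N + 1)) ∂μ :=
        integral_mono (hui M) ((hi1.add hi2).add (integrable_const _)) fun ω =>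
          subadditive_process_le_of_visits hC hu hsub hℓ0
            (liminf_div_comp_le hC h0 hu hK) hε.le N M ω
      rw [integral_add (f := fun ω => M * (ℓ ω + ε) + 2 * C * ∑ j ∈ Finset.range M,
          (B N).indicator (fun _ => (1 : ℝ)) (τ^[j] ω)) (hi1.add hi2) (integrable_const _),
        integral_add hi1 hi2, integral_const_mul, integral_const_mul,
        integral_add hℓi (integrable_const ε), integral_finsetSum _ fun j _ => hindi j] at h1
      simp only [hindv, integral_const, probReal_univ, one_smul, Finset.sum_const,
        Finset.card_range, nsmul_eq_mul] at h1
      have h2 : 2 * C * (M * μ.real (B N)) ≤ 2 * C * (M * ε) := by gcongr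
      linarith [hlam M]
    have hlim : Tendsto (fun M : ℕ => (∫ ω, ℓ ω ∂μ + (1 + 2 * C) * ε) + C * (N + 1) / (M : ℝ))
        atTop (𝓝 (∫ ω, ℓ ω ∂μ + (1 + 2 * C) * ε)) := by
      simpa using (tendsto_const_div_atTop_nhds_zero_nat (C * ((N : ℝ) + 1))).const_add
        (∫ ω, ℓ ω ∂μ + (1 + 2 * C) * ε)
    refine ge_of_tendsto hlim ?_
    filter_upwards [eventually_gt_atTop 0] with M hM0
    have hM0' : (0 : ℝ) < M := by exact_mod_cast hM0
    have := hM M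
    rw [← sub_le_iff_le_add', le_div_iff₀ hM0']
    linarith
  refine le_of_forall_pos_le_add fun δ hδ => ?_
  have := key (δ / (1 + 2 * C)) (by positivity)
  rwa [mul_div_cancel₀ _ (by linarith)] at this

/-- The subadditive ergodic theorem for a process whose upper growth rate is known to be bounded by
the normalized means. -/
theorem ae_tendsto_div_of_subadditive_process (hτ : MeasurePreserving τ μ μ)
    (hm : ∀ n, Measurable (u n)) (hC : 0 ≤ C) (h0 : ∀ n ω, 0 ≤ u n ω)
    (hu : ∀ n ω, u n ω ≤ C * (n + 1))
    (hsub : ∀ m n ω, u (m + n) ω ≤ u m ω + u n (τ^[m] ω))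
    (hK : ∀ n ω, u n (τ ω) ≤ u (n + 1) ω + K)
    (hupper : ∀ k : ℕ, 0 < k → ∀ᵐ ω ∂μ, ∀ c, (∫ ω, u k ω ∂μ) / k < c →
      ∀ᶠ n : ℕ in atTop, u n ω / n < c) :
    ∃ lam, ∀ᵐ ω ∂μ, Tendsto (fun n : ℕ => u n ω / n) atTop (𝓝 lam) := by
  have hui (n : ℕ) : Integrable (u n) μ := .of_bound (hm n).aestronglyMeasurable (C * (n + 1))
    (.of_forall fun ω => by rw [Real.norm_of_nonneg (h0 n ω)]; exact hu n ω)
  have hS : Subadditive fun n => ∫ ω, u n ω ∂μ := by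
    intro m n
    have hc : Integrable (fun ω => u n (τ^[m] ω)) μ :=
      (hτ.iterate m).integrable_comp_of_integrable (hui n)
    have he : ∫ ω, u n (τ^[m] ω) ∂μ = ∫ ω, u n ω ∂μ := by
      have := integral_map (hτ.iterate m).measurable.aemeasurable
        ((hm n).aestronglyMeasurable (μ := μ.map τ^[m]))
      rw [(hτ.iterate m).map_eq] at this
      exact this.symm
    simp only
    rw [← he, ← integral_add (hui m) hc]
    exact integral_mono (hui _) ((hui m).add hc) (hsub m n)
  have hbdd : BddBelow (Set.range fun n : ℕ => (∫ ω, u n ω ∂μ) / n) := by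
    refine ⟨0, ?_⟩
    rintro _ ⟨n, rfl⟩
    exact div_nonneg (integral_nonneg (h0 n)) n.cast_nonneg
  have hlam (n : ℕ) : n * hS.lim ≤ ∫ ω, u n ω ∂μ := by
    rcases n.eq_zero_or_pos with rfl | hn
    · simpa using integral_nonneg (h0 0)
    · have := hS.lim_le_div hbdd hn.ne'
      rwa [le_div_iff₀ (by exact_mod_cast hn), mul_comm] at this
  have hle : ∀ᵐ ω ∂μ, ∀ c, hS.lim < c → ∀ᶠ n : ℕ in atTop, u n ω / n < c := by
    have : ∀ᵐ ω ∂μ, ∀ k : ℕ, 0 < k → ∀ c, (∫ ω, u k ω ∂μ) / k < c →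
        ∀ᶠ n : ℕ in atTop, u n ω / n < c := by
      rw [ae_all_iff]
      intro k
      by_cases hk : 0 < k
      · simpa [hk] using hupper k hk
      · simp [hk]
    filter_upwards [this] with ω hω c hc
    obtain ⟨k, h1, h2⟩ := (((hS.tendsto_lim hbdd).eventually_lt_const hc).and
      (eventually_gt_atTop 0)).exists
    exact hω k h2 c h1
  have hℓle : (fun ω => liminf (fun n : ℕ => u n ω / n) atTop) ≤ᵐ[μ] fun _ => hS.lim := by
    filter_upwards [hle] with ω hω
    refine le_of_forall_gt_imp_ge_of_dense fun c hc => ?_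
    exact liminf_le_of_frequently_le ((hω c hc).mono fun _ h => h.le).frequently
      (isBoundedUnder_ge_div h0 ω)
  have hℓi : Integrable (fun ω => liminf (fun n : ℕ => u n ω / n) atTop) μ := by
    refine .of_bound (Measurable.liminf fun n => (hm n).div_const _).aestronglyMeasurable (2 * C)
      (.of_forall fun ω => ?_)
    rw [Real.norm_of_nonneg (le_liminf_of_le (isCoboundedUnder_ge_div hC hu ω)
      (Eventually.of_forall fun n => div_nonneg (h0 n ω) n.cast_nonneg))]
    exact liminf_le_of_frequently_le
      (Eventually.of_forall fun n => div_le_of_le_mul_succ hC hu n ω).frequently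
      (isBoundedUnder_ge_div h0 ω)
  have hint := le_integral_liminf_of_subadditive_process hτ hm hC h0 hu hsub hK hlam
  -- The liminf is almost everywhere at most `hS.lim` but has integral at least `hS.lim`, so they
  -- agree almost everywhere. No ergodicity is used here.
  have heq := (integral_eq_iff_of_ae_le hℓi (integrable_const hS.lim) hℓle).1
    (le_antisymm (integral_mono_ae hℓi (integrable_const _) hℓle) (by simpa using hint))
  refine ⟨hS.lim, ?_⟩
  filter_upwards [hle, heq] with ω h1 h2
  refine tendsto_order.2 ⟨fun a ha => ?_, h1⟩
  exact eventually_lt_of_lt_liminf (ha.trans_eq h2.symm) (isBoundedUnder_ge_div h0 ω)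

end SubadditiveErgodic

/-! ### Independent blocks under the Bernoulli shift -/

theorem shift_iterate_apply (m : ℕ) (ω : ℕ → Fin 2) (j : ℕ) : shift^[m] ω j = ω (j + m) := by
  induction m generalizing ω with
  | zero => rfl
  | succ m ih => rw [Function.iterate_succ_apply, ih, shift, add_assoc]

theorem measurePreserving_shift (p : unitInterval) :
    MeasurePreserving shift (bernoulliSeq p) (bernoulliSeq p) :=
  ⟨measurable_pi_lambda _ fun n => measurable_pi_apply (n + 1),
    Measure.map_infinitePi_infinitePi_of_inj (P := fun _ : ℕ => symbolMeasure p)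
      (add_left_injective 1)⟩

instance (p : unitInterval) : IsProbabilityMeasure (bernoulliSeq p) := by
  unfold bernoulliSeq; infer_instance

/-- A function of the first `k` symbols, evaluated after `m` shifts, as a function of the symbols
with indices in `[m, m + k)`. -/
def windowFun (f : (ℕ → Fin 2) → ℝ) (m k : ℕ) (y : Finset.Ico m (m + k) → Fin 2) : ℝ :=
  f fun j => if h : j + m ∈ Finset.Ico m (m + k) then y ⟨j + m, h⟩ else 0

/-- The default symbol `0` only fills indices from `k` on, which `f` ignores. -/
theorem windowFun_restrict {f : (ℕ → Fin 2) → ℝ} {k : ℕ}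
    (hf : ∀ ω ω' : ℕ → Fin 2, (∀ j < k, ω j = ω' j) → f ω = f ω') (m : ℕ) (ω : ℕ → Fin 2) :
    windowFun f m k (fun j => ω j) = f (shift^[m] ω) := by
  refine hf _ _ fun j hj => ?_
  have : j + m ∈ Finset.Ico m (m + k) := by simp; omega
  simp only [this, dite_true, shift_iterate_apply]

theorem measurable_windowFun (f : (ℕ → Fin 2) → ℝ) (m k : ℕ) : Measurable (windowFun f m k) :=
  measurable_of_countable _

theorem measurable_of_depends_finite {f : (ℕ → Fin 2) → ℝ} {k : ℕ}
    (hf : ∀ ω ω' : ℕ → Fin 2, (∀ j < k, ω j = ω' j) → f ω = f ω') : Measurable f := by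
  have : f = fun ω => windowFun f 0 k (fun j => ω j) := by
    funext ω
    exact (windowFun_restrict hf 0 ω).symm
  rw [this]
  exact (measurable_windowFun f 0 k).comp (measurable_pi_lambda _ fun j => measurable_pi_apply _)

theorem indepFun_shift_iterate (p : unitInterval) {f : (ℕ → Fin 2) → ℝ} {k : ℕ}
    (hf : ∀ ω ω' : ℕ → Fin 2, (∀ j < k, ω j = ω' j) → f ω = f ω') {m n : ℕ} (hmn : m + k ≤ n) :
    ProbabilityTheory.IndepFun (fun ω => f (shift^[m] ω)) (fun ω => f (shift^[n] ω))
      (bernoulliSeq p) := by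
  have hi : ProbabilityTheory.iIndepFun (fun (i : ℕ) (ω : ℕ → Fin 2) => ω i) (bernoulliSeq p) :=
    ProbabilityTheory.iIndepFun_infinitePi (X := fun _ x => x) fun _ => measurable_id
  have hd : Disjoint (Finset.Ico m (m + k)) (Finset.Ico n (n + k)) := by
    rw [Finset.disjoint_left]
    intro a h1 h2
    simp only [Finset.mem_Ico] at h1 h2
    omega
  have := (hi.indepFun_finset _ _ hd fun i => measurable_pi_apply i).comp
    (measurable_windowFun f m k) (measurable_windowFun f n k)
  simpa only [Function.comp_def, windowFun_restrict hf] using this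

theorem ae_tendsto_block_average (p : unitInterval) {f : (ℕ → Fin 2) → ℝ} {k : ℕ}
    (hf : ∀ ω ω' : ℕ → Fin 2, (∀ j < k, ω j = ω' j) → f ω = f ω')
    (hint : Integrable f (bernoulliSeq p)) :
    ∀ᵐ ω ∂bernoulliSeq p, Tendsto
      (fun n : ℕ => (∑ i ∈ Finset.range n, f (shift^[i * k] ω)) / n) atTop
      (𝓝 (∫ ω, f ω ∂bernoulliSeq p)) := by
  have hfm := measurable_of_depends_finite hf
  have hmp (j : ℕ) := (measurePreserving_shift p).iterate j
  have := ProbabilityTheory.strong_law_ae_real (μ := bernoulliSeq p)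
    (fun i ω => f (shift^[i * k] ω)) (by simpa using hint) ?_ fun i => ?_
  · simpa using this
  · intro i j hij
    rcases hij.lt_or_gt with h | h
    -- From `i < j` follows `i * k + k ≤ j * k`: the windows are disjoint.
    · exact indepFun_shift_iterate p hf (by nlinarith)
    · exact (indepFun_shift_iterate p hf (by nlinarith)).symm
  · refine ⟨(hfm.comp (hmp _).measurable).aemeasurable, (hfm.comp (hmp _).measurable).aemeasurable,
      ?_⟩
    have h (j : ℕ) : Measure.map (fun ω => f (shift^[j] ω)) (bernoulliSeq p) =
        Measure.map f (bernoulliSeq p) := by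
      have := Measure.map_map (μ := bernoulliSeq p) hfm (hmp j).measurable
      rw [(hmp j).map_eq] at this
      exact this.symm
    rw [h, h]

theorem le_sum_blocks {u : ℕ → (ℕ → Fin 2) → ℝ}
    (hsub : ∀ m n ω, u (m + n) ω ≤ u m ω + u n (shift^[m] ω)) (k m r : ℕ) (ω : ℕ → Fin 2) :
    u (m * k + r) ω ≤ ∑ i ∈ Finset.range m, u k (shift^[i * k] ω) + u r (shift^[m * k] ω) := by
  induction m generalizing r with
  | zero => simp
  | succ m ih =>
    -- The remainder is arbitrary, so the new block can first be absorbed into it and then split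
    -- off.
    have h1 := ih (k + r)
    have h2 := hsub k r (shift^[m * k] ω)
    rw [← Function.iterate_add_apply] at h2
    rw [Finset.sum_range_succ, show (m + 1) * k + r = m * k + (k + r) by ring,
      show (m + 1) * k = k + m * k by ring]
    linarith

/-- Cut `n` steps into `n / k` blocks of length `k` and a remainder costing at most `C * (k + 1)`;
the strong law gives the average over the blocks. -/
theorem ae_eventually_div_lt (p : unitInterval) {u : ℕ → (ℕ → Fin 2) → ℝ} {C : ℝ}
    (hloc : ∀ n, ∀ ω ω' : ℕ → Fin 2, (∀ j < n, ω j = ω' j) → u n ω = u n ω')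
    (hC : 0 ≤ C) (h0 : ∀ n ω, 0 ≤ u n ω) (hu : ∀ n ω, u n ω ≤ C * (n + 1))
    (hsub : ∀ m n ω, u (m + n) ω ≤ u m ω + u n (shift^[m] ω)) {k : ℕ} (hk : 0 < k) :
    ∀ᵐ ω ∂bernoulliSeq p, ∀ c, (∫ ω, u k ω ∂bernoulliSeq p) / k < c →
      ∀ᶠ n : ℕ in atTop, u n ω / n < c := by
  have hint : Integrable (u k) (bernoulliSeq p) :=
    .of_bound (measurable_of_depends_finite (hloc k)).aestronglyMeasurable (C * (k + 1))
      (.of_forall fun ω => by rw [Real.norm_of_nonneg (h0 k ω)]; exact hu k ω)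
  filter_upwards [ae_tendsto_block_average p (hloc k) hint] with ω hω c hc
  have hk' : (0 : ℝ) < k := by exact_mod_cast hk
  have h1 : Tendsto (fun n : ℕ => (∑ i ∈ Finset.range (n / k), u k (shift^[i * k] ω)) /
      ((n / k : ℕ) : ℝ) / k + C * (k + 1) / n) atTop
      (𝓝 ((∫ ω, u k ω ∂bernoulliSeq p) / k)) := by
    have := ((hω.comp (Nat.tendsto_div_const_atTop hk.ne')).div_const (k : ℝ)).add
      (tendsto_const_div_atTop_nhds_zero_nat (C * ((k : ℝ) + 1)))
    rw [add_zero] at this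
    exact this
  filter_upwards [h1.eventually_lt_const hc, eventually_ge_atTop k] with n h2 h3
  refine lt_of_le_of_lt ?_ h2
  have hq : 0 < n / k := Nat.div_pos h3 hk
  have hq' : (0 : ℝ) < (n / k : ℕ) := by exact_mod_cast hq
  have h4 := le_sum_blocks hsub k (n / k) (n % k) ω
  rw [Nat.div_add_mod' n k] at h4
  have h5 : u (n % k) (shift^[n / k * k] ω) ≤ C * (k + 1) := by
    refine (hu _ _).trans ?_
    have : ((n % k : ℕ) : ℝ) ≤ k := by exact_mod_cast (Nat.mod_lt n hk).le
    gcongr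
  have h6 : ((n / k : ℕ) : ℝ) * k ≤ n := by exact_mod_cast Nat.div_mul_le_self n k
  have hn : (0 : ℝ) < n := by exact_mod_cast hk.trans_le h3
  have h7 : 0 ≤ ∑ i ∈ Finset.range (n / k), u k (shift^[i * k] ω) :=
    Finset.sum_nonneg fun _ _ => h0 _ _
  calc u n ω / n ≤ (∑ i ∈ Finset.range (n / k), u k (shift^[i * k] ω) + C * (k + 1)) / n := by
        gcongr; linarith
    _ = (∑ i ∈ Finset.range (n / k), u k (shift^[i * k] ω)) / n + C * (k + 1) / n := add_div _ _ _
    _ ≤ _ := by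
        rw [div_div]
        gcongr

/-! ### Growth of the matrix products and the conclusion -/

theorem cocycle_add (A : Fin 2 → Matrix (Fin 2) (Fin 2) ℝ) (ω : ℕ → Fin 2) (m n : ℕ) :
    cocycle A ω (m + n) = cocycle A (shift^[m] ω) n * cocycle A ω m := by
  induction n with
  | zero => simp [cocycle]
  | succ n ih =>
    rw [← add_assoc, cocycle, ih, cocycle, shift_iterate_apply, Matrix.mul_assoc, add_comm n m]

theorem cocycle_congr (A : Fin 2 → Matrix (Fin 2) (Fin 2) ℝ) {ω ω' : ℕ → Fin 2} {n : ℕ}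
    (h : ∀ j < n, ω j = ω' j) : cocycle A ω n = cocycle A ω' n := by
  induction n with
  | zero => rfl
  | succ n ih => rw [cocycle, cocycle, h n n.lt_succ_self, ih fun j hj => h j (by omega)]

theorem frobSq_adjugate (M : Matrix (Fin 2) (Fin 2) ℝ) : frobSq M.adjugate = frobSq M := by
  rw [frobSq_eq, frobSq_eq, Matrix.adjugate_fin_two]
  simp
  ring

/-- Multiply `N * B` by `B⁻¹`, which is the adjugate and has the same Frobenius norm as `B`. -/
theorem frobSq_le_mul {B : Matrix (Fin 2) (Fin 2) ℝ} (hB : B.det = 1)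
    (N : Matrix (Fin 2) (Fin 2) ℝ) : frobSq N ≤ frobSq (N * B) * frobSq B := by
  have h := frobSq_mul_le (N * B) B.adjugate
  rwa [Matrix.mul_assoc, Matrix.mul_adjugate, hB, one_smul, Matrix.mul_one, frobSq_adjugate] at h

theorem frobSq_cocycle_le {A : Fin 2 → Matrix (Fin 2) (Fin 2) ℝ} (hA : ∀ i, (A i).det = 1)
    {β : ℝ} (hβ : ∀ i, frobSq (A i) ≤ β) (ω : ℕ → Fin 2) (n : ℕ) :
    frobSq (cocycle A ω n) ≤ β ^ (n + 1) := by
  have h2 : 2 ≤ β := (two_le_frobSq (hA 0)).trans (hβ 0)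
  induction n with
  -- The exponent `n + 1` absorbs `frobSq 1 = 2 ≤ β`.
  | zero => simpa [cocycle, frobSq] using h2
  | succ n ih =>
    rw [cocycle, pow_succ']
    exact (frobSq_mul_le _ _).trans (mul_le_mul (hβ _) ih
      (by linarith [two_le_frobSq (cocycle_det hA ω n)]) (by linarith))

/-- The Furstenberg–Kesten theorem for Bernoulli products of matrices of determinant `1`. -/
theorem ae_tendsto_log_frobSq_cocycle {A : Fin 2 → Matrix (Fin 2) (Fin 2) ℝ}
    (hA : ∀ i, (A i).det = 1) (p : unitInterval) :
    ∃ L, ∀ᵐ ω ∂bernoulliSeq p,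
      Tendsto (fun n : ℕ => Real.log (frobSq (cocycle A ω n)) / n) atTop (𝓝 L) := by
  have hT (ω : ℕ → Fin 2) (n : ℕ) := two_le_frobSq (cocycle_det hA ω n)
  obtain ⟨β, hβ⟩ := (Set.finite_range fun i => frobSq (A i)).bddAbove
  have hβ (i : Fin 2) : frobSq (A i) ≤ β := hβ ⟨i, rfl⟩
  have hβ2 : 2 ≤ β := (two_le_frobSq (hA 0)).trans (hβ 0)
  have hC : 0 ≤ Real.log β := Real.log_nonneg (by linarith)
  have h0 (n : ℕ) (ω : ℕ → Fin 2) : 0 ≤ Real.log (frobSq (cocycle A ω n)) :=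
    Real.log_nonneg (by linarith [hT ω n])
  have hu (n : ℕ) (ω : ℕ → Fin 2) :
      Real.log (frobSq (cocycle A ω n)) ≤ Real.log β * (n + 1) := by
    refine (Real.log_le_log (by linarith [hT ω n]) (frobSq_cocycle_le hA hβ ω n)).trans_eq ?_
    rw [Real.log_pow]
    push_cast
    ring
  have hsub (m n : ℕ) (ω : ℕ → Fin 2) : Real.log (frobSq (cocycle A ω (m + n))) ≤
      Real.log (frobSq (cocycle A ω m)) + Real.log (frobSq (cocycle A (shift^[m] ω) n)) := by
    have h1 := hT ω m
    have h2 := hT (shift^[m] ω) n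
    rw [add_comm (Real.log _), ← Real.log_mul (by linarith) (by linarith)]
    refine Real.log_le_log (by linarith [hT ω (m + n)]) ?_
    rw [cocycle_add]
    exact frobSq_mul_le _ _
  have hK (n : ℕ) (ω : ℕ → Fin 2) : Real.log (frobSq (cocycle A (shift ω) n)) ≤
      Real.log (frobSq (cocycle A ω (n + 1))) + Real.log β := by
    have h1 := hT ω (n + 1)
    have h2 := hT (shift ω) n
    rw [← Real.log_mul (by linarith) (by linarith)]
    refine Real.log_le_log (by linarith) ?_
    have h3 : cocycle A ω (n + 1) = cocycle A (shift ω) n * A (ω 0) := by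
      rw [add_comm, cocycle_add]
      simp [cocycle]
    rw [h3] at h1 ⊢
    refine (frobSq_le_mul (hA (ω 0)) _).trans ?_
    gcongr
    exact hβ _
  have hloc (n : ℕ) (ω ω' : ℕ → Fin 2) (h : ∀ j < n, ω j = ω' j) :
      Real.log (frobSq (cocycle A ω n)) = Real.log (frobSq (cocycle A ω' n)) := by
    rw [cocycle_congr A h]
  exact ae_tendsto_div_of_subadditive_process (u := fun n ω => Real.log (frobSq (cocycle A ω n)))
    (measurePreserving_shift p) (fun n => measurable_of_depends_finite (hloc n)) hC h0 hu hsub hK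
    fun k hk => ae_eventually_div_lt p hloc hC h0 hu hsub hk

theorem ae_exists_isOseledetsLimit {A : Fin 2 → Matrix (Fin 2) (Fin 2) ℝ}
    (hA : ∀ i, (A i).det = 1) (p : unitInterval) :
    ∀ᵐ ω ∂bernoulliSeq p, ∃ Λ, IsOseledetsLimit (cocycle A ω) Λ := by
  obtain ⟨L, hL⟩ := ae_tendsto_log_frobSq_cocycle hA p
  obtain ⟨β, hβ⟩ := (Set.finite_range fun i => frobSq (A i)).bddAbove
  filter_upwards [hL] with ω hω
  exact exists_isOseledetsLimit (B := fun n => A (ω n)) (cocycle_det hA ω) (fun n => hA _)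
    (fun n => hβ ⟨ω n, rfl⟩) (fun n => rfl) hω

/-- Enclose the exceptional set in a measurable null set and keep the points whose whole forward
orbit avoids it. -/
theorem exists_measurableSet_mapsTo_of_ae {Ω : Type*} [MeasurableSpace Ω] {μ : Measure Ω}
    [IsProbabilityMeasure μ] {τ : Ω → Ω} (hτ : MeasurePreserving τ μ μ) {P : Ω → Prop}
    (hP : ∀ᵐ ω ∂μ, P ω) :
    ∃ Γ, MeasurableSet Γ ∧ Set.MapsTo τ Γ Γ ∧ μ Γ = 1 ∧ ∀ ω ∈ Γ, P ω := by
  obtain ⟨s, hs, hsm, hs0⟩ := exists_measurable_superset_of_null (ae_iff.1 hP)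
  have hm (k : ℕ) : MeasurableSet (τ^[k] ⁻¹' sᶜ) := (hτ.iterate k).measurable hsm.compl
  refine ⟨⋂ k, τ^[k] ⁻¹' sᶜ, .iInter hm, fun ω hω => ?_, ?_, fun ω hω => ?_⟩
  · rw [Set.mem_iInter] at hω ⊢
    intro k
    have := hω (k + 1)
    rwa [Set.mem_preimage, Function.iterate_succ_apply] at this
  · rw [← prob_compl_eq_zero_iff (.iInter hm), Set.compl_iInter, measure_iUnion_null_iff]
    intro k
    rw [← Set.preimage_compl, compl_compl,
      (hτ.iterate k).measure_preimage hsm.nullMeasurableSet, hs0]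
  · by_contra h
    exact Set.mem_iInter.1 hω 0 (hs h)

theorem mainTheorem4 (A : Fin 2 → Matrix (Fin 2) (Fin 2) ℝ) (hA : ∀ i, (A i).det = 1)
    (p : unitInterval) :
    -- almost surely, `Λ_ω` exists
    (∃ Γ : Set (ℕ → Fin 2), MeasurableSet Γ ∧ Set.MapsTo shift Γ Γ ∧ bernoulliSeq p Γ = 1 ∧
      ∀ ω ∈ Γ, ∃ Λ, IsOseledetsLimit (cocycle A ω) Λ) ∧
    -- the cocycle of the inverse transposes
    (∀ (ω : ℕ → Fin 2) (n : ℕ),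
      cocycle (fun i => tilde (A i)) ω n = tilde (cocycle A ω n)) ∧
    -- its limit, wherever `Λ_ω` exists
    (∀ (ω : ℕ → Fin 2) (Λ : Matrix (Fin 2) (Fin 2) ℝ), IsOseledetsLimit (cocycle A ω) Λ →
      Λ.det = 1 ∧
      IsOseledetsLimit (cocycle (fun i => tilde (A i)) ω) (symplJ * Λ * symplJ⁻¹) ∧
      symplJ * Λ * symplJ⁻¹ = Λ⁻¹) ∧
    -- its Lyapunov exponents and growth rates
    (∀ ω : ℕ → Fin 2,
      lyapunovExponents (cocycle (fun i => tilde (A i)) ω) = lyapunovExponents (cocycle A ω) ∧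
      growthRates (cocycle (fun i => tilde (A i)) ω) = growthRates (cocycle A ω)) := by
  have hc (ω : ℕ → Fin 2) :
      cocycle (fun i => tilde (A i)) ω = fun n => tilde (cocycle A ω n) :=
    funext (cocycle_tilde A ω)
  have htt (ω : ℕ → Fin 2) : (fun n => tilde (tilde (cocycle A ω n))) = cocycle A ω :=
    funext fun n => tilde_tilde (cocycle_det hA ω n)
  refine ⟨exists_measurableSet_mapsTo_of_ae (measurePreserving_shift p)
    (ae_exists_isOseledetsLimit hA p), cocycle_tilde A, fun ω Λ h => ?_, fun ω => ?_⟩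
  · have hd := cocycle_det hA ω
    refine ⟨h.det_eq_one hd, ?_, conj_symplJ_eq_inv (h.det_eq_one hd) (h.transpose_eq hd)⟩
    rw [hc]
    exact h.tilde hd
  · have hd := cocycle_det hA ω
    have hd' (n : ℕ) := tilde_det (hd n)
    -- `tilde` is an involution here, so the inclusion applied to the tilde cocycle gives the
    -- reverse one.
    have h1 := lyapunovExponents_subset_tilde hd'
    have h2 := growthRates_subset_tilde hd'
    rw [htt] at h1 h2
    rw [hc]
    exact ⟨h1.antisymm (lyapunovExponents_subset_tilde hd),
      h2.antisymm (growthRates_subset_tilde hd)⟩
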